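/- Let $\mathfrak F$ be the class of finite groups. For a group $G$, let $\mathfrak F\cap G$ be the family of finite subgroups of $G$. A cellular action of $G$ on a CW-complex is an action by homeomorphisms that permute the open cells, preserving their dimension, and such that the setwise stabilizer of each cell fixes that cell pointwise. Let $\mathbf H^{\mathfrak F}\mathfrak F$ be the smallest class of groups (closed under isomorphism) that contains all finite groups and has the following property: if a group $G$ acts cellularly on a finite dimensional CW-complex $X$ such that all isotropy groups $G_x$, $x\in X$, belong to the class and the fixed point set $X^S$ is contractible for every $S\in\mathfrak F\cap G$, then $G$ belongs to the class. Then $\mathbf H^{\mathfrak F}\mathfrak F$ is closed under countable directed unions, amalgamated free products and HNN-extensions. That is: (1) If a group $G$ is the union of a countable directed family of subgroups, each of which is in $\mathbf H^{\mathfrak F}\mathfrak F$, then $G$ is in $\mathbf H^{\mathfrak F}\mathfrak F$. (2) If $A_0$ and $A_1$ are in $\mathbf H^{\mathfrak F}\mathfrak F$ and $C$ is any group with injective homomorphisms $C\to A_0$ and $C\to A_1$, then the amalgamated free product $A_0*_C A_1$ is in $\mathbf H^{\mathfrak F}\mathfrak F$. (3) If $K$ is in $\mathbf H^{\mathfrak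 F}\mathfrak F$, $A,B\le K$ are subgroups and $\varphi\colon A\to B$ is an isomorphism, then the HNN-extension $K*_\varphi=\langle K,t\mid tat^{-1}=\varphi(a)\ (a\in A)\rangle$ is in $\mathbf H^{\mathfrak F}\mathfrak F$. -/

import Mathlib

open Topology

universe u

/-- A class of groups, in the universe `u`. -/
abbrev GroupClass : Type (u + 1) := (G : Type u) → [Group G] → Prop

/-- The class of finite groups. -/
def FiniteGroups : GroupClass.{u} := fun G _ => Finite G

/-- The family `𝔉 ∩ G` of those subgroups of `G` that are isomorphic to a group in `𝔉`. -/
def GroupClass.family (𝔉 : GroupClass.{u}) (G : Type u) [Group G] : Set (Subgroup G) :=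
  {S | ∃ (K : Type u) (_ : Group K), 𝔉 K ∧ Nonempty (S ≃* K)}

/-- The group `G` acts cellularly on the CW-complex `X`: it acts by homeomorphisms that permute the
open cells (preserving dimension), and the setwise stabilizer of a cell fixes that cell
pointwise. -/
structure IsCellularAction (G X : Type u) [Group G] [MulAction G X] [TopologicalSpace X]
    [CWComplex (Set.univ : Set X)] : Prop where
  continuous_smul (g : G) : Continuous fun x : X => g • x
  exists_image_eq (g : G) (n : ℕ) (i : RelCWComplex.cell (Set.univ : Set X) n) :
    ∃ j : RelCWComplex.cell (Set.univ : Set X) n,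
      (fun x : X => g • x) '' RelCWComplex.openCell n i = RelCWComplex.openCell n j
  smul_eq_of_image_eq (g : G) (n : ℕ) (i : RelCWComplex.cell (Set.univ : Set X) n) :
    (fun x : X => g • x) '' RelCWComplex.openCell n i = RelCWComplex.openCell n i →
      ∀ x ∈ RelCWComplex.openCell n i, g • x = x

/-- The class `H^𝔉 𝔛`: the smallest class of groups (closed under isomorphism) that contains `𝔛`
and contains each group `G` that acts cellularly on a finite dimensional CW-complex `X` with all
isotropy groups in the class and with `X^S` contractible for all `S ∈ 𝔉 ∩ G`.

Mathlib's `CWComplex` does not include the Hausdorff axiom, so `T2Space X` is added. -/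
inductive HierarchyClass (𝔉 𝔛 : GroupClass.{u}) : (G : Type u) → [Group G] → Prop
  | of_mem {G K : Type u} [Group G] [Group K] (e : G ≃* K) (hK : 𝔛 K) : HierarchyClass 𝔉 𝔛 G
  | of_action {G : Type u} [Group G] (X : Type u) [TopologicalSpace X] [T2Space X]
      [CWComplex (Set.univ : Set X)] [MulAction G X]
      (hdim : RelCWComplex.FiniteDimensional (Set.univ : Set X))
      (hact : IsCellularAction G X)
      (hiso : ∀ x : X, HierarchyClass 𝔉 𝔛 (MulAction.stabilizer G x))
      (hfix : ∀ S ∈ GroupClass.family 𝔉 G, ContractibleSpace (MulAction.fixedPoints S X)) :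
      HierarchyClass 𝔉 𝔛 G

/-! In all three cases the group acts on a tree: the tree of cosets of an increasing sequence of
subgroups, or a Bass-Serre tree. Vertex stabilizers are conjugates of the given groups, so
`HierarchyClass.of_tree` finishes the proof once the realization of such a tree is shown to be an
admissible complex.

It is a one-dimensional CW-complex. Stabilizers of points on edges lie in vertex stabilizers, and
the class is closed under subgroups (`HierarchyClass.of_injective`). A finite subgroup `S` fixes a
vertex `r`, a centre of an orbit (`SimpleGraph.IsTree.exists_forall_smul_eq`). Contracting the tree
to `r` along geodesics commutes with `S`, so it contracts the fixed point set
(`IsRooting.contractibleSpace_fixedPoints`). Inversions are excluded by an integral level that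
changes by one along each edge and is preserved by elements of finite order.

That the Bass-Serre graphs have no cycles is shown without normal forms. The group acts affinely on
its integral functions, with translations as linear parts, so that an orbit map from the vertices to
the functions changes along the edge of `g` by the indicator of the coset of `g` modulo the edge
group. Evaluated at `g`, this potential jumps along that edge only, so each edge is a bridge. Normal
forms enter only through the injectivity of the vertex groups. -/

/-! ### Realization of a graph as a one-dimensional CW-complex. -/

/-- The points of the geometric realization of the directed graph with vertices `V`, edges `E`,
and end points `src` and `tgt`: the vertices, and an open interval for each edge. -/
def GraphRealization {V E : Type u} (_src _tgt : E → V) : Type u :=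
  V ⊕ E × Set.Ioo (-1 : ℝ) 1

namespace GraphRealization

variable {V E : Type u} {src tgt : E → V}

/-- A vertex as a point of the realization. -/
def vertex (v : V) : GraphRealization src tgt := Sum.inl v

/-- The point of an open edge with a given parameter. -/
def inner (e : E) (s : Set.Ioo (-1 : ℝ) 1) : GraphRealization src tgt := Sum.inr (e, s)

@[elab_as_elim]
lemma cases_point {motive : GraphRealization src tgt → Prop} (x : GraphRealization src tgt)
    (vertex : ∀ v, motive (vertex v)) (inner : ∀ e s, motive (inner e s)) : motive x := by
  rcases x with v | ⟨e, s⟩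
  exacts [vertex v, inner e s]

lemma vertex_injective : Function.Injective (vertex : V → GraphRealization src tgt) :=
  Sum.inl_injective

@[simp]
lemma inner_inj {e e' : E} {s s' : Set.Ioo (-1 : ℝ) 1} :
    (inner e s : GraphRealization src tgt) = inner e' s' ↔ e = e' ∧ s = s' := by
  exact Sum.inr_injective.eq_iff.trans Prod.mk_inj

@[simp]
lemma inner_ne_vertex {v : V} {e : E} {s : Set.Ioo (-1 : ℝ) 1} :
    (inner e s : GraphRealization src tgt) ≠ vertex v := Sum.inr_ne_inl

open Classical in
/-- The path along an edge, constant outside of `[-1, 1]`. -/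
noncomputable def edgePath (e : E) (s : ℝ) : GraphRealization src tgt :=
  if h : s ∈ Set.Ioo (-1 : ℝ) 1 then inner e ⟨s, h⟩
  else if s ≤ -1 then vertex (src e) else vertex (tgt e)

lemma edgePath_of_mem {e : E} {s : ℝ} (h : s ∈ Set.Ioo (-1 : ℝ) 1) :
    (edgePath e s : GraphRealization src tgt) = inner e ⟨s, h⟩ := dif_pos h

lemma edgePath_of_le {e : E} {s : ℝ} (h : s ≤ -1) :
    (edgePath e s : GraphRealization src tgt) = vertex (src e) := by
  rw [edgePath, dif_neg (fun h' => absurd h'.1 (not_lt.2 h)), if_pos h]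

lemma edgePath_of_ge {e : E} {s : ℝ} (h : 1 ≤ s) :
    (edgePath e s : GraphRealization src tgt) = vertex (tgt e) := by
  rw [edgePath, dif_neg (fun h' => absurd h'.2 (not_lt.2 h)), if_neg (by linarith)]

/-- Case distinction on the parameter of `edgePath`. -/
lemma edgePath_cases (s : ℝ) : s ≤ -1 ∨ s ∈ Set.Ioo (-1 : ℝ) 1 ∨ 1 ≤ s := by
  rcases le_or_gt s (-1) with h | h
  · exact .inl h
  · rcases lt_or_ge s 1 with h' | h'
    exacts [.inr (.inl ⟨h, h'⟩), .inr (.inr h')]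

/-- The weak topology: a set is closed if its preimage under each edge path is. -/
noncomputable instance : TopologicalSpace (GraphRealization src tgt) :=
  ⨆ e : E, TopologicalSpace.coinduced (edgePath e) inferInstance

/-- Vertices need no condition of their own: an end point is seen by the paths of its edges, and an
isolated vertex is open. -/
lemma continuous_iff {Y : Type*} [TopologicalSpace Y] {f : GraphRealization src tgt → Y} :
    Continuous f ↔ ∀ e, Continuous fun s => f (edgePath e s) := by
  simp only [continuous_iSup_dom, continuous_coinduced_dom]
  rfl

lemma continuous_edgePath (e : E) :
    Continuous (edgePath e : ℝ → GraphRealization src tgt) :=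
  continuous_iff.1 continuous_id e

lemma isClosed_iff {A : Set (GraphRealization src tgt)} :
    IsClosed A ↔ ∀ e, IsClosed (edgePath e ⁻¹' A) := by
  simp only [isClosed_iSup_iff, isClosed_coinduced]

/-- The truncation of a real number to `[-1, 1]`. -/
noncomputable def clamp (s : ℝ) : ℝ := max (-1) (min s 1)

lemma continuous_clamp : Continuous clamp := by unfold clamp; fun_prop

lemma clamp_of_le {s : ℝ} (h : s ≤ -1) : clamp s = -1 := by
  rw [clamp, min_eq_left (by linarith), max_eq_left h]

lemma clamp_of_ge {s : ℝ} (h : 1 ≤ s) : clamp s = 1 := by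
  rw [clamp, min_eq_right h, max_eq_right (by norm_num)]

lemma clamp_of_mem {s : ℝ} (h : s ∈ Set.Ioo (-1 : ℝ) 1) : clamp s = s := by
  rw [clamp, min_eq_left h.2.le, max_eq_right h.1.le]

/-- The extension of a function on the vertices that is affine on the edges. -/
noncomputable def affineExtension (f : V → ℝ) : GraphRealization src tgt → ℝ :=
  Sum.elim f fun q => f (src q.1) * ((1 - q.2) / 2) + f (tgt q.1) * ((1 + q.2) / 2)

@[simp]
lemma affineExtension_vertex (f : V → ℝ) (v : V) :
    affineExtension f (vertex v : GraphRealization src tgt) = f v := rfl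

@[simp]
lemma affineExtension_inner (f : V → ℝ) (e : E) (s : Set.Ioo (-1 : ℝ) 1) :
    affineExtension f (inner e s : GraphRealization src tgt) =
      f (src e) * ((1 - s) / 2) + f (tgt e) * ((1 + s) / 2) := rfl

lemma affineExtension_edgePath (f : V → ℝ) (e : E) (s : ℝ) :
    affineExtension f (edgePath e s : GraphRealization src tgt) =
      f (src e) * ((1 - clamp s) / 2) + f (tgt e) * ((1 + clamp s) / 2) := by
  rcases edgePath_cases s with h | h | h
  · rw [edgePath_of_le h, clamp_of_le h]; simp
  · rw [edgePath_of_mem h, clamp_of_mem h]; simp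
  · rw [edgePath_of_ge h, clamp_of_ge h]; simp

lemma continuous_affineExtension (f : V → ℝ) :
    Continuous (affineExtension f : GraphRealization src tgt → ℝ) := by
  refine continuous_iff.2 fun e => ?_
  simp only [affineExtension_edgePath]
  have := continuous_clamp
  fun_prop

open Classical in
/-- A function that is positive exactly on the open edge `e`. -/
noncomputable def tent (e : E) : GraphRealization src tgt → ℝ :=
  Sum.elim (fun _ => 0) fun q => if q.1 = e then 1 - (q.2 : ℝ) ^ 2 else 0

@[simp]
lemma tent_vertex (e : E) (v : V) : tent e (vertex v : GraphRealization src tgt) = 0 := rfl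

open Classical in
@[simp]
lemma tent_inner (e e' : E) (s : Set.Ioo (-1 : ℝ) 1) :
    tent e (inner e' s : GraphRealization src tgt) = if e' = e then 1 - (s : ℝ) ^ 2 else 0 := rfl

lemma tent_inner_pos (e : E) (s : Set.Ioo (-1 : ℝ) 1) :
    0 < tent e (inner e s : GraphRealization src tgt) := by
  have := s.2.1
  have := s.2.2
  rw [tent_inner, if_pos rfl]
  nlinarith

lemma continuous_tent (e : E) : Continuous (tent e : GraphRealization src tgt → ℝ) := by
  classical
  refine continuous_iff.2 fun e' => ?_
  have key : ∀ s, tent e (edgePath e' s : GraphRealization src tgt) =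
      if e' = e then 1 - (clamp s) ^ 2 else 0 := by
    intro s
    rcases edgePath_cases s with h | h | h
    · rw [edgePath_of_le h, clamp_of_le h]; simp
    · rw [edgePath_of_mem h, clamp_of_mem h]; simp
    · rw [edgePath_of_ge h, clamp_of_ge h]; simp
  simp only [key]
  have := continuous_clamp
  split_ifs <;> fun_prop

open Classical in
lemma affineExtension_indicator_inner {e : E} (he : src e ≠ tgt e) (s : Set.Ioo (-1 : ℝ) 1) :
    affineExtension (fun v => if v = tgt e then 1 else 0) (inner e s : GraphRealization src tgt) =
      (1 + s) / 2 := by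
  simp [he]

/-- Real functions separate points: `tent` isolates an open edge, and affine extensions of
indicators separate two vertices, or two points of one edge because its end points differ. -/
lemma t2Space (hne : ∀ e, src e ≠ tgt e) : T2Space (GraphRealization src tgt) := by
  classical
  have key : ∀ x y : GraphRealization src tgt, x ≠ y →
      ∃ f : GraphRealization src tgt → ℝ, Continuous f ∧ f x ≠ f y := by
    intro x y hxy
    induction x using cases_point with
    | vertex v =>
      induction y using cases_point with
      | vertex w =>
        refine ⟨_, continuous_affineExtension (fun u => if u = v then 1 else 0), ?_⟩
        have : w ≠ v := fun h => hxy (by rw [h])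
        simp [this]
      | inner e s => exact ⟨_, continuous_tent e, (tent_inner_pos e s).ne⟩
    | inner e s =>
      induction y using cases_point with
      | vertex w => exact ⟨_, continuous_tent e, (tent_inner_pos e s).ne'⟩
      | inner e' s' =>
        by_cases h : e' = e
        · subst h
          refine ⟨_, continuous_affineExtension (fun u => if u = tgt e' then 1 else 0), ?_⟩
          rw [affineExtension_indicator_inner (hne e'), affineExtension_indicator_inner (hne e')]
          intro h
          exact hxy (by rw [Subtype.ext (by linarith : (s : ℝ) = s')])
        · refine ⟨_, continuous_tent e, ?_⟩
          have := tent_inner_pos (src := src) (tgt := tgt) e s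
          rw [tent_inner e e', if_neg h]
          exact this.ne'
  refine ⟨fun x y hxy => ?_⟩
  obtain ⟨f, hf, hne⟩ := key x y hxy
  exact separated_by_continuous hf hne

/-- The parameter of a point on an open edge. -/
def parameter : GraphRealization src tgt → ℝ := Sum.elim (fun _ => 0) fun q => q.2

lemma mem_ball_fin_one {x : Fin 1 → ℝ} : x ∈ Metric.ball 0 1 ↔ x 0 ∈ Set.Ioo (-1 : ℝ) 1 := by
  rw [mem_ball_zero_iff, pi_norm_lt_iff one_pos]
  simp [abs_lt]

lemma mem_closedBall_fin_one {x : Fin 1 → ℝ} :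
    x ∈ Metric.closedBall 0 1 ↔ x 0 ∈ Set.Icc (-1 : ℝ) 1 := by
  rw [mem_closedBall_zero_iff, pi_norm_le_iff_of_nonneg zero_le_one]
  simp [abs_le]

/-- The characteristic map of a `0`-cell. -/
noncomputable def vertexMap (v : V) : PartialEquiv (Fin 0 → ℝ) (GraphRealization src tgt) where
  toFun _ := vertex v
  invFun _ := 0
  source := Metric.ball 0 1
  target := {vertex v}
  map_source' := by simp
  map_target' := by simp
  left_inv' _ _ := Subsingleton.elim _ _
  right_inv' := by simp

/-- The characteristic map of a `1`-cell. -/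
noncomputable def edgeMap (e : E) : PartialEquiv (Fin 1 → ℝ) (GraphRealization src tgt) where
  toFun x := edgePath e (x 0)
  invFun y _ := parameter y
  source := Metric.ball 0 1
  target := Set.range (inner e)
  map_source' x hx := ⟨⟨x 0, mem_ball_fin_one.1 hx⟩, (edgePath_of_mem _).symm⟩
  map_target' := by
    rintro _ ⟨s, rfl⟩
    exact mem_ball_fin_one.2 s.2
  left_inv' x hx := by
    rw [edgePath_of_mem (mem_ball_fin_one.1 hx)]
    ext i
    rw [Subsingleton.elim i 0]
    rfl
  right_inv' := by
    rintro _ ⟨s, rfl⟩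
    exact edgePath_of_mem s.2

/-- The cells of the realization of a graph. -/
def Cell (V E : Type u) : ℕ → Type u
  | 0 => V
  | 1 => E
  | _ + 2 => PEmpty

/-- The characteristic maps of the realization of a graph. -/
noncomputable def cellMap : (n : ℕ) → Cell V E n →
    PartialEquiv (Fin n → ℝ) (GraphRealization src tgt)
  | 0, v => vertexMap v
  | 1, e => edgeMap e
  | _ + 2, i => i.elim

lemma vertexMap_image_of_nonempty (v : V) {B : Set (Fin 0 → ℝ)} (hB : B.Nonempty) :
    (vertexMap v : PartialEquiv _ (GraphRealization src tgt)) '' B = {vertex v} :=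
  hB.image_const _

lemma edgeMap_image_ball (e : E) :
    (edgeMap e : PartialEquiv _ (GraphRealization src tgt)) '' Metric.ball 0 1 =
      Set.range (inner e) :=
  (edgeMap e).image_source_eq_target

lemma edgePath_mem_image_closedBall (e : E) (s : ℝ) :
    (edgePath e s : GraphRealization src tgt) ∈
      (edgeMap e : PartialEquiv _ (GraphRealization src tgt)) '' Metric.closedBall 0 1 := by
  rcases edgePath_cases s with h | h | h
  · exact ⟨fun _ => -1, mem_closedBall_fin_one.2 (by norm_num),
      (edgePath_of_le le_rfl).trans (edgePath_of_le h).symm⟩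
  · exact ⟨fun _ => s, mem_closedBall_fin_one.2 (Set.Ioo_subset_Icc_self h), rfl⟩
  · exact ⟨fun _ => 1, mem_closedBall_fin_one.2 (by norm_num),
      (edgePath_of_ge le_rfl).trans (edgePath_of_ge h).symm⟩

/-- On the open edge, the affine extension `f` of the indicator of `tgt e` is `(1 + s) / 2`, so the
parameter is the restriction of the globally continuous `2 * f - 1`. -/
lemma continuousOn_edgeMap_symm {e : E} (he : src e ≠ tgt e) :
    ContinuousOn (edgeMap e : PartialEquiv _ (GraphRealization src tgt)).symm
      (edgeMap e : PartialEquiv _ (GraphRealization src tgt)).target := by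
  classical
  have h : Continuous fun (x : GraphRealization src tgt) (_ : Fin 1) =>
      2 * affineExtension (fun v => if v = tgt e then 1 else 0) x - 1 := by
    have := continuous_affineExtension (src := src) (tgt := tgt)
      (fun v => if v = tgt e then 1 else 0)
    fun_prop
  refine h.continuousOn.congr ?_
  rintro _ ⟨s, rfl⟩
  ext i
  simp only [affineExtension_indicator_inner he]
  change (s : ℝ) = _
  ring

lemma vertexMap_image_ball (v : V) :
    (vertexMap v : PartialEquiv _ (GraphRealization src tgt)) '' Metric.ball 0 1 = {vertex v} :=
  vertexMap_image_of_nonempty v ⟨0, by simp⟩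

lemma disjoint_vertex_vertex {v w : V} (h : v ≠ w) :
    Disjoint ((vertexMap v : PartialEquiv _ (GraphRealization src tgt)) '' Metric.ball 0 1)
      ((vertexMap w : PartialEquiv _ (GraphRealization src tgt)) '' Metric.ball 0 1) := by
  rw [vertexMap_image_ball, vertexMap_image_ball, Set.disjoint_singleton]
  exact fun h' => h (vertex_injective h')

lemma disjoint_vertex_edge (v : V) (e : E) :
    Disjoint ((vertexMap v : PartialEquiv _ (GraphRealization src tgt)) '' Metric.ball 0 1)
      ((edgeMap e : PartialEquiv _ (GraphRealization src tgt)) '' Metric.ball 0 1) := by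
  rw [vertexMap_image_ball, edgeMap_image_ball, Set.disjoint_singleton_left]
  rintro ⟨s, hs⟩
  exact inner_ne_vertex hs

lemma disjoint_edge_edge {e e' : E} (h : e ≠ e') :
    Disjoint ((edgeMap e : PartialEquiv _ (GraphRealization src tgt)) '' Metric.ball 0 1)
      ((edgeMap e' : PartialEquiv _ (GraphRealization src tgt)) '' Metric.ball 0 1) := by
  rw [edgeMap_image_ball, edgeMap_image_ball, Set.disjoint_left]
  rintro _ ⟨s, rfl⟩ ⟨s', hs⟩
  exact h (inner_inj.1 hs).1.symm

lemma edgeMap_of_mem_sphere (e : E) {x : Fin 1 → ℝ} (hx : x ∈ Metric.sphere 0 1) :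
    vertex (src e) = (edgeMap e x : GraphRealization src tgt) ∨
      vertex (tgt e) = (edgeMap e x : GraphRealization src tgt) := by
  change _ = edgePath e (x 0) ∨ _ = edgePath e (x 0)
  rcases edgePath_cases (x 0) with h | h | h
  · exact .inl (edgePath_of_le h).symm
  · exact absurd (mem_sphere_zero_iff_norm.1 hx)
      (mem_ball_zero_iff.1 (mem_ball_fin_one.2 h)).ne
  · exact .inr (edgePath_of_ge h).symm

/-- The realization of a graph without loops is a CW-complex. -/
@[reducible]
noncomputable def cwComplex (hne : ∀ e, src e ≠ tgt e) :
    CWComplex (Set.univ : Set (GraphRealization src tgt)) where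
  cell := Cell V E
  map := cellMap
  source_eq
    | 0, _ => rfl
    | 1, _ => rfl
    | _ + 2, i => i.elim
  continuousOn
    | 0, _ => continuousOn_const
    | 1, e => ((continuous_edgePath e).comp (continuous_apply 0)).continuousOn
    | _ + 2, i => i.elim
  continuousOn_symm
    | 0, _ => continuousOn_const
    | 1, e => continuousOn_edgeMap_symm (hne e)
    | _ + 2, i => i.elim
  pairwiseDisjoint' := by
    rintro ⟨n, i⟩ - ⟨m, j⟩ - hij
    match n, i, m, j, hij with
    | 0, v, 0, w, hij => exact disjoint_vertex_vertex fun h => hij (congrArg (Sigma.mk 0) h)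
    | 0, v, 1, e, _ => exact disjoint_vertex_edge v e
    | 1, e, 0, v, _ => exact (disjoint_vertex_edge v e).symm
    | 1, e, 1, e', hij => exact disjoint_edge_edge fun h => hij (congrArg (Sigma.mk 1) h)
    | _ + 2, i, _, _, _ => exact i.elim
    | _, _, _ + 2, j, _ => exact j.elim
  mapsTo'
    -- The unit sphere of the zero space is empty, so a `0`-cell has no boundary.
    | 0, _ => ⟨fun _ => ∅, fun x hx => absurd (mem_sphere_zero_iff_norm.1 hx) (by
        rw [Subsingleton.elim x 0, norm_zero]; exact zero_ne_one)⟩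
    | 1, e => by
      classical
      refine ⟨fun m => match m with
        | 0 => ({src e, tgt e} : Finset V)
        | _ + 1 => ∅, fun x hx => ?_⟩
      simp only [Set.mem_iUnion]
      rcases edgeMap_of_mem_sphere e hx with h | h
      · exact ⟨0, one_pos, src e, Finset.mem_insert_self _ _, 0, by simp, h⟩
      · exact ⟨0, one_pos, tgt e, Finset.mem_insert_of_mem (Finset.mem_singleton_self _), 0,
          by simp, h⟩
    | _ + 2, i => i.elim
  closed' A _ hA := by
    refine isClosed_iff.2 fun e => ?_
    convert (hA 1 e).preimage (continuous_edgePath e) using 1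
    ext s
    exact ⟨fun h => ⟨h, edgePath_mem_image_closedBall e s⟩, fun h => h.1⟩
  union' := by
    refine Set.eq_univ_of_forall fun x => ?_
    simp only [Set.mem_iUnion]
    induction x using cases_point with
    | vertex v => exact ⟨0, v, 0, by simp, rfl⟩
    | inner e s =>
      refine ⟨1, e, ?_⟩
      have := edgePath_mem_image_closedBall (src := src) (tgt := tgt) e s
      rwa [edgePath_of_mem s.2] at this

lemma finiteDimensional (hne : ∀ e, src e ≠ tgt e) :
    letI := cwComplex hne
    RelCWComplex.FiniteDimensional (Set.univ : Set (GraphRealization src tgt)) := by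
  let := cwComplex hne
  refine ⟨Filter.eventually_atTop.2 ⟨2, fun n hn => ?_⟩⟩
  obtain ⟨k, rfl⟩ := Nat.exists_eq_add_of_le' hn
  exact inferInstanceAs (IsEmpty PEmpty)

/-! ### The cellular action induced by an action on a graph. -/

section Action

variable {G : Type u} [Group G] [MulAction G V] [MulAction G E]

instance : MulAction G (GraphRealization src tgt) where
  smul g := Sum.map (fun v => g • v) fun q => (g • q.1, q.2)
  one_smul x := by
    induction x using cases_point with
    | vertex v => exact congrArg vertex (one_smul G v)
    | inner e s => exact congrArg (inner · s) (one_smul G e)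
  mul_smul g h x := by
    induction x using cases_point with
    | vertex v => exact congrArg vertex (mul_smul g h v)
    | inner e s => exact congrArg (inner · s) (mul_smul g h e)

@[simp]
lemma smul_vertex (g : G) (v : V) :
    g • (vertex v : GraphRealization src tgt) = vertex (g • v) := rfl

@[simp]
lemma smul_inner (g : G) (e : E) (s : Set.Ioo (-1 : ℝ) 1) :
    g • (inner e s : GraphRealization src tgt) = inner (g • e) s := rfl

lemma smul_edgePath (hs : ∀ (g : G) e, src (g • e) = g • src e)
    (ht : ∀ (g : G) e, tgt (g • e) = g • tgt e) (g : G) (e : E) (s : ℝ) :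
    g • (edgePath e s : GraphRealization src tgt) = edgePath (g • e) s := by
  rcases edgePath_cases s with h | h | h
  · rw [edgePath_of_le h, edgePath_of_le h, smul_vertex, hs]
  · rw [edgePath_of_mem h, edgePath_of_mem h, smul_inner]
  · rw [edgePath_of_ge h, edgePath_of_ge h, smul_vertex, ht]

lemma smul_image_vertexMap (g : G) (v : V) :
    (fun x : GraphRealization src tgt => g • x) '' (vertexMap v '' Metric.ball 0 1) =
      vertexMap (g • v) '' Metric.ball 0 1 := by
  rw [vertexMap_image_ball, vertexMap_image_ball, Set.image_singleton, smul_vertex]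

lemma smul_image_edgeMap (g : G) (e : E) :
    (fun x : GraphRealization src tgt => g • x) '' (edgeMap e '' Metric.ball 0 1) =
      edgeMap (g • e) '' Metric.ball 0 1 := by
  rw [edgeMap_image_ball, edgeMap_image_ball, ← Set.range_comp]
  rfl

lemma smul_eq_of_image_vertexMap (g : G) (v : V)
    (h : (fun x : GraphRealization src tgt => g • x) '' (vertexMap v '' Metric.ball 0 1) =
      vertexMap v '' Metric.ball 0 1)
    (x : GraphRealization src tgt) (hx : x ∈ vertexMap v '' Metric.ball 0 1) : g • x = x := by
  rw [vertexMap_image_ball] at h hx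
  rw [Set.image_singleton, Set.singleton_eq_singleton_iff] at h
  rw [Set.mem_singleton_iff.1 hx, h]

/-- The action preserves parameters, so it cannot flip an edge. -/
lemma smul_eq_of_image_edgeMap (g : G) (e : E)
    (h : (fun x : GraphRealization src tgt => g • x) '' (edgeMap e '' Metric.ball 0 1) =
      edgeMap e '' Metric.ball 0 1)
    (x : GraphRealization src tgt) (hx : x ∈ edgeMap e '' Metric.ball 0 1) : g • x = x := by
  rw [edgeMap_image_ball] at h hx
  obtain ⟨s, rfl⟩ := hx
  obtain ⟨s', hs'⟩ := h.subset (Set.mem_image_of_mem _ (Set.mem_range_self s))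
  rw [smul_inner, ← (inner_inj.1 (hs'.trans (smul_inner g e s))).1]

lemma isCellularAction (hne : ∀ e, src e ≠ tgt e)
    (hs : ∀ (g : G) e, src (g • e) = g • src e)
    (ht : ∀ (g : G) e, tgt (g • e) = g • tgt e) :
    letI := cwComplex hne
    IsCellularAction G (GraphRealization src tgt) := by
  let := cwComplex hne
  refine ⟨fun g => ?_, fun g n i => ?_, fun g n i => ?_⟩
  · refine continuous_iff.2 fun e => ?_
    simp only [smul_edgePath hs ht]
    exact continuous_edgePath _
  · match n, i with
    | 0, v => exact ⟨_, smul_image_vertexMap (V := V) (E := E) g v⟩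
    | 1, e => exact ⟨_, smul_image_edgeMap (V := V) (E := E) g e⟩
    | _ + 2, i => exact i.elim
  · match n, i with
    | 0, v => exact smul_eq_of_image_vertexMap (V := V) (E := E) g v
    | 1, e => exact smul_eq_of_image_edgeMap (V := V) (E := E) g e
    | _ + 2, i => exact i.elim

end Action

end GraphRealization

/-- The geometric realization of a relation, viewed as a directed graph. -/
abbrev RelRealization {V : Type u} (R : V → V → Prop) : Type u :=
  GraphRealization (fun e : {q : V × V // R q.1 q.2} => e.1.1) (fun e => e.1.2)

/-- The action on the edges of a directed graph that is induced by an action on the vertices. -/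
@[reducible]
def edgeAction {V : Type u} {R : V → V → Prop} {G : Type u} [Group G] [MulAction G V]
    (hR : ∀ (g : G) x y, R x y → R (g • x) (g • y)) : MulAction G {q : V × V // R q.1 q.2} where
  smul g e := ⟨g • e.1, hR g _ _ e.2⟩
  one_smul e := Subtype.ext (one_smul G e.1)
  mul_smul g h e := Subtype.ext (mul_smul g h e.1)

/-! ### Contraction of a rooted tree along geodesics. -/

/-- The relation `R` is the edge relation of an oriented tree with root `r`, where `d` is the
distance from the root and `p` maps each vertex to its neighbour in the direction of the root. -/
structure IsRooting {V : Type u} (R : V → V → Prop) (r : V) (d : V → ℕ) (p : V → V) : Prop where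
  eq_root {v : V} : d v = 0 → v = r
  depth_parent {v : V} : d v ≠ 0 → d (p v) + 1 = d v
  rel_parent {v : V} : d v ≠ 0 → R (p v) v ∨ R v (p v)
  eq_parent {x y : V} : R x y → (d y = d x + 1 ∧ p y = x) ∨ (d x = d y + 1 ∧ p x = y)
  asymm {x y : V} : R x y → ¬ R y x

namespace IsRooting

open GraphRealization

variable {V : Type u} {R : V → V → Prop} {r : V} {d : V → ℕ} {p : V → V}

open Classical in
/-- The path from the parent of `v` to `v`, parametrized by `[0, 1]`. -/
noncomputable def parentPath (R : V → V → Prop) (p : V → V) (v : V) (s : ℝ) : RelRealization R :=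
  -- The affine change of parameter from `[0, 1]` to `[-1, 1]` is reversed when the edge points
  -- towards the root; the last case is a default value.
  if h : R (p v) v then edgePath ⟨(p v, v), h⟩ (2 * s - 1)
  else if h : R v (p v) then edgePath ⟨(v, p v), h⟩ (1 - 2 * s)
  else vertex v

lemma continuous_parentPath (v : V) : Continuous (parentPath R p v) := by
  unfold parentPath
  split_ifs with h h'
  · exact (continuous_edgePath _).comp (by fun_prop)
  · exact (continuous_edgePath _).comp (by fun_prop)
  · exact continuous_const

lemma parentPath_of_ge {v : V} {s : ℝ} (hs : 1 ≤ s) : parentPath R p v s = vertex v := by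
  unfold parentPath
  split_ifs with h h'
  · exact edgePath_of_ge (by linarith)
  · exact edgePath_of_le (by linarith)
  · rfl

lemma parentPath_of_le (H : IsRooting R r d p) {v : V} (hv : d v ≠ 0) {s : ℝ} (hs : s ≤ 0) :
    parentPath R p v s = vertex (p v) := by
  unfold parentPath
  split_ifs with h h'
  · exact edgePath_of_le (by linarith)
  · exact edgePath_of_ge (by linarith)
  · exact absurd (H.rel_parent hv) (by tauto)

lemma parentPath_eq_of_tgt {x y : V} (h : R x y) (hp : p y = x) (s : ℝ) :
    parentPath R p y s = edgePath ⟨(x, y), h⟩ (2 * s - 1) := by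
  subst hp
  rw [parentPath, dif_pos h]

lemma parentPath_eq_of_src (H : IsRooting R r d p) {x y : V} (h : R x y) (hp : p x = y) (s : ℝ) :
    parentPath R p x s = edgePath ⟨(x, y), h⟩ (1 - 2 * s) := by
  subst hp
  rw [parentPath, dif_neg (H.asymm h), dif_pos h]

/-- The geodesic from the root to a vertex `v` of depth `n`, parametrized by `[0, n]`. -/
noncomputable def branch (R : V → V → Prop) (p : V → V) : ℕ → V → ℝ → RelRealization R
  | 0, v, _ => vertex v
  | n + 1, v, s => if s ≤ n then branch R p n (p v) s else parentPath R p v (s - n)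

lemma branch_of_ge {n : ℕ} {v : V} {s : ℝ} (hs : n ≤ s) : branch R p n v s = vertex v := by
  cases n with
  | zero => rfl
  | succ n =>
    push_cast at hs
    rw [branch, if_neg (by linarith), parentPath_of_ge (by linarith)]

/-- The definition uses the shorter branch at `s = n`; both formulas give the parent there. -/
lemma branch_of_depth_le (H : IsRooting R r d p) {n : ℕ} {v : V} (hv : d v = n + 1) {s : ℝ}
    (hs : n ≤ s) : branch R p (n + 1) v s = parentPath R p v (s - n) := by
  rcases hs.eq_or_lt with rfl | hs
  · rw [branch, if_pos le_rfl, branch_of_ge le_rfl, H.parentPath_of_le (by omega) (by simp)]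
  · rw [branch, if_neg (by linarith)]

lemma continuous_branch (H : IsRooting R r d p) {n : ℕ} {v : V} (hv : d v = n) :
    Continuous (branch R p n v) := by
  induction n generalizing v with
  | zero => exact continuous_const
  | succ n ih =>
    have hp : d (p v) = n := by have := H.depth_parent (v := v) (by omega); omega
    refine Continuous.if_le (ih hp) ((continuous_parentPath v).comp (by fun_prop))
      continuous_id continuous_const fun s hs => ?_
    change s = n at hs
    rw [hs, branch_of_ge le_rfl, H.parentPath_of_le (by omega) (by simp)]

lemma branch_zero (H : IsRooting R r d p) {n : ℕ} {v : V} (hv : d v = n) :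
    branch R p n v 0 = vertex r := by
  induction n generalizing v with
  | zero => rw [branch, H.eq_root hv]
  | succ n ih =>
    have hp : d (p v) = n := by have := H.depth_parent (v := v) (by omega); omega
    rw [branch, if_pos (Nat.cast_nonneg n), ih hp]

/-- The vertex itself for a vertex, and the end point further from the root for a point of an open
edge. -/
def farEnd (d : V → ℕ) : RelRealization R → V :=
  Sum.elim id fun q => if d q.1.1.1 ≤ d q.1.1.2 then q.1.1.2 else q.1.1.1

/-- The distance from the root. -/
noncomputable def depth (d : V → ℕ) : RelRealization R → ℝ := affineExtension fun v => (d v : ℝ)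

lemma continuous_depth : Continuous (depth d : RelRealization R → ℝ) :=
  continuous_affineExtension _

/-- The contraction to the root along geodesics. -/
noncomputable def contraction (R : V → V → Prop) (d : V → ℕ) (p : V → V) (x : RelRealization R)
    (t : ℝ) : RelRealization R :=
  branch R p (d (farEnd d x)) (farEnd d x) ((1 - t) * depth d x)

lemma contraction_vertex (v : V) (t : ℝ) :
    contraction R d p (vertex v) t = branch R p (d v) v ((1 - t) * d v) := rfl

/-- The geodesic to a child extends that to its parent. Hence a single branch, that of the far end,
describes the contraction on a whole closed edge, including the near end. -/
lemma branch_parent {v w : V} (hd : d w = d v + 1) (hp : p w = v) {t : ℝ}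
    (ht : 0 ≤ t) : branch R p (d w) w ((1 - t) * d v) = branch R p (d v) v ((1 - t) * d v) := by
  rw [hd, branch, if_pos (by nlinarith [(d v).cast_nonneg (α := ℝ)]), hp]

lemma contraction_edgePath_of_tgt {x y : V} (h : R x y)
    (hd : d y = d x + 1) (hp : p y = x) (s : ℝ) {t : ℝ} (ht : 0 ≤ t) :
    contraction R d p (edgePath ⟨(x, y), h⟩ s) t =
      branch R p (d y) y ((1 - t) * depth d (edgePath ⟨(x, y), h⟩ s : RelRealization R)) := by
  rcases edgePath_cases s with hs | hs | hs
  · rw [edgePath_of_le hs]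
    exact (branch_parent hd hp ht).symm
  · rw [edgePath_of_mem hs, contraction]
    have : farEnd d (inner ⟨(x, y), h⟩ ⟨s, hs⟩ : RelRealization R) = y :=
      if_pos (show d x ≤ d y by omega)
    rw [this]
  · rw [edgePath_of_ge hs]
    rfl

lemma contraction_edgePath_of_src {x y : V} (h : R x y)
    (hd : d x = d y + 1) (hp : p x = y) (s : ℝ) {t : ℝ} (ht : 0 ≤ t) :
    contraction R d p (edgePath ⟨(x, y), h⟩ s) t =
      branch R p (d x) x ((1 - t) * depth d (edgePath ⟨(x, y), h⟩ s : RelRealization R)) := by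
  rcases edgePath_cases s with hs | hs | hs
  · rw [edgePath_of_le hs]
    rfl
  · rw [edgePath_of_mem hs, contraction]
    have : farEnd d (inner ⟨(x, y), h⟩ ⟨s, hs⟩ : RelRealization R) = x :=
      if_neg (show ¬ d x ≤ d y by omega)
    rw [this]
  · rw [edgePath_of_ge hs]
    exact (branch_parent hd hp ht).symm

lemma contraction_zero (H : IsRooting R r d p) (x : RelRealization R) :
    contraction R d p x 0 = x := by
  induction x using cases_point with
  | vertex v => rw [contraction_vertex, branch_of_ge (by simp)]
  | inner e s =>
    obtain ⟨⟨x, y⟩, h⟩ := e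
    have hs1 := s.2.1
    have hs2 := s.2.2
    have hs : (inner ⟨(x, y), h⟩ s : RelRealization R) = edgePath ⟨(x, y), h⟩ s :=
      (edgePath_of_mem s.2).symm
    have hdep : depth d (edgePath ⟨(x, y), h⟩ s : RelRealization R) =
        d x * ((1 - s) / 2) + d y * ((1 + s) / 2) := by
      rw [depth, affineExtension_edgePath, clamp_of_mem s.2]
    rw [hs]
    rcases H.eq_parent h with ⟨hd, hp⟩ | ⟨hd, hp⟩
    · rw [contraction_edgePath_of_tgt h hd hp _ le_rfl, hdep]
      -- The point lies on the last segment of the branch at local time `(1 + s) / 2`, which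
      -- `parentPath` turns back into the edge parameter `s`.
      have e1 : (1 - 0) * ((d x : ℝ) * ((1 - s) / 2) + d y * ((1 + s) / 2)) =
          d x + (1 + s) / 2 := by rw [hd]; push_cast; ring
      rw [e1, hd, H.branch_of_depth_le hd (by linarith), parentPath_eq_of_tgt h hp]
      congr 1; ring
    · rw [contraction_edgePath_of_src h hd hp _ le_rfl, hdep]
      have e1 : (1 - 0) * ((d x : ℝ) * ((1 - s) / 2) + d y * ((1 + s) / 2)) =
          d y + (1 - s) / 2 := by rw [hd]; push_cast; ring
      rw [e1, hd, H.branch_of_depth_le hd (by linarith), H.parentPath_eq_of_src h hp]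
      congr 1; ring

lemma contraction_one (H : IsRooting R r d p) (x : RelRealization R) :
    contraction R d p x 1 = vertex r := by
  rw [contraction, sub_self, zero_mul, H.branch_zero rfl]

lemma continuous_contraction (H : IsRooting R r d p) :
    Continuous fun x : RelRealization R × unitInterval => contraction R d p x.1 x.2 := by
  have hc (x : RelRealization R) : Continuous fun t : unitInterval => contraction R d p x t :=
    (H.continuous_branch rfl).comp (by fun_prop)
  -- The weak topology tests maps out of the realization, not out of its product with the interval.
  -- Currying moves the time variable to the target; local compactness of the interval allows
  -- uncurrying.
  let f : RelRealization R → C(unitInterval, RelRealization R) :=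
    fun x => ⟨fun t => contraction R d p x t, hc x⟩
  have hf : Continuous f := by
    refine continuous_iff.2 fun e => ?_
    refine ContinuousMap.continuous_of_continuous_uncurry _ ?_
    obtain ⟨⟨x, y⟩, h⟩ := e
    have hdep : Continuous fun q : ℝ × unitInterval =>
        (1 - (q.2 : ℝ)) * depth d (edgePath ⟨(x, y), h⟩ q.1 : RelRealization R) := by
      have := (continuous_depth (d := d)).comp
        (continuous_edgePath (src := fun e : {q : V × V // R q.1 q.2} => e.1.1)
          (tgt := fun e => e.1.2) ⟨(x, y), h⟩)
      exact (by fun_prop : Continuous fun q : ℝ × unitInterval => (1 - (q.2 : ℝ))).mul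
        (this.comp continuous_fst)
    rcases H.eq_parent h with ⟨hd, hp⟩ | ⟨hd, hp⟩
    · refine ((H.continuous_branch (v := y) rfl).comp hdep).congr fun q => ?_
      exact (contraction_edgePath_of_tgt h hd hp q.1 q.2.2.1).symm
    · refine ((H.continuous_branch (v := x) rfl).comp hdep).congr fun q => ?_
      exact (contraction_edgePath_of_src h hd hp q.1 q.2.2.1).symm
  exact ContinuousMap.continuous_uncurry_of_continuous ⟨f, hf⟩

section Action

variable {G : Type u} [Group G] [MulAction G V] {g : G}

lemma smul_parentPath (hR : ∀ (g : G) x y, R x y → R (g • x) (g • y))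
    (hp : ∀ v, p (g • v) = g • p v) (v : V) (s : ℝ) :
    letI := edgeAction hR
    g • parentPath R p v s = parentPath R p (g • v) s := by
  let := edgeAction hR
  have hiff (x y : V) : R (g • x) (g • y) ↔ R x y :=
    ⟨fun h => by simpa using hR g⁻¹ _ _ h, hR g x y⟩
  have hedge (x y : V) (h : R x y) (s : ℝ) :
      g • (edgePath ⟨(x, y), h⟩ s : RelRealization R) =
        edgePath ⟨(g • x, g • y), hR g x y h⟩ s :=
    smul_edgePath (fun _ _ => rfl) (fun _ _ => rfl) g _ s
  unfold parentPath
  by_cases h : R (p v) v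
  · have hg : R (p (g • v)) (g • v) := by rwa [hp, hiff]
    rw [dif_pos h, dif_pos hg]
    simp only [hp]
    exact hedge _ _ h _
  · have hg : ¬ R (p (g • v)) (g • v) := by rwa [hp, hiff]
    rw [dif_neg h, dif_neg hg]
    by_cases h' : R v (p v)
    · have hg' : R (g • v) (p (g • v)) := by rwa [hp, hiff]
      rw [dif_pos h', dif_pos hg']
      simp only [hp]
      exact hedge _ _ h' _
    · have hg' : ¬ R (g • v) (p (g • v)) := by rwa [hp, hiff]
      rw [dif_neg h', dif_neg hg']
      rfl

lemma smul_branch (hR : ∀ (g : G) x y, R x y → R (g • x) (g • y))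
    (hp : ∀ v, p (g • v) = g • p v) (n : ℕ) (v : V) (s : ℝ) :
    letI := edgeAction hR
    g • branch R p n v s = branch R p n (g • v) s := by
  let := edgeAction hR
  induction n generalizing v with
  | zero => rfl
  | succ n ih =>
    rw [branch, branch, hp]
    split_ifs
    · exact ih _
    · exact smul_parentPath hR hp v _

/-- Equivariance makes the contraction preserve the fixed point set. -/
lemma smul_contraction (hR : ∀ (g : G) x y, R x y → R (g • x) (g • y))
    (hd : ∀ v, d (g • v) = d v) (hp : ∀ v, p (g • v) = g • p v) (x : RelRealization R) (t : ℝ) :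
    letI := edgeAction hR
    g • contraction R d p x t = contraction R d p (g • x) t := by
  let := edgeAction hR
  have hfar : farEnd d (g • x) = g • farEnd d x := by
    induction x using cases_point with
    | vertex v => rfl
    | inner e s =>
      change (if d (g • e.1.1) ≤ d (g • e.1.2) then g • e.1.2 else g • e.1.1) =
        g • (if d e.1.1 ≤ d e.1.2 then e.1.2 else e.1.1)
      rw [hd, hd, smul_ite]
  have hdep : depth d (g • x) = depth d x := by
    induction x using cases_point with
    | vertex v => exact congrArg Nat.cast (hd v)
    | inner e s =>
      change (d (g • e.1.1) : ℝ) * _ + d (g • e.1.2) * _ = d e.1.1 * _ + d e.1.2 * _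
      rw [hd, hd]
  rw [contraction, contraction, hfar, hdep, hd]
  exact smul_branch hR hp _ _ _

/-- The points fixed by a group that respects the rooting form a contractible space. -/
lemma contractibleSpace_fixedPoints (H : IsRooting R r d p)
    (hR : ∀ (g : G) x y, R x y → R (g • x) (g • y)) (S : Subgroup G)
    (hr : ∀ g ∈ S, g • r = r) (hd : ∀ g ∈ S, ∀ v, d (g • v) = d v)
    (hp : ∀ g ∈ S, ∀ v, p (g • v) = g • p v) :
    letI := edgeAction hR
    ContractibleSpace (MulAction.fixedPoints S (RelRealization R)) := by
  let := edgeAction hR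
  have hmem (x : MulAction.fixedPoints S (RelRealization R)) (t : ℝ) :
      contraction R d p x.1 t ∈ MulAction.fixedPoints S (RelRealization R) := fun g =>
    (smul_contraction hR (hd g.1 g.2) (hp g.1 g.2) x.1 t).trans
      (congrArg (contraction R d p · t) (x.2 g))
  have hroot : (vertex r : RelRealization R) ∈ MulAction.fixedPoints S (RelRealization R) :=
    fun g => congrArg vertex (hr g.1 g.2)
  refine (contractible_iff_id_nullhomotopic _).2 ⟨⟨vertex r, hroot⟩, ⟨?_⟩⟩
  exact
    { toFun := fun q => ⟨contraction R d p q.2.1 q.1, hmem q.2 q.1⟩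
      continuous_toFun := by
        refine Continuous.subtype_mk ?_ _
        exact H.continuous_contraction.comp
          ((continuous_subtype_val.comp continuous_snd).prodMk continuous_fst)
      map_zero_left := fun x => Subtype.ext (H.contraction_zero x.1)
      map_one_left := fun x => Subtype.ext (H.contraction_one x.1) }

end Action

end IsRooting

/-! ### Distances in trees and fixed vertices of finite groups. -/

namespace SimpleGraph

variable {V : Type u} {T : SimpleGraph V}

lemma Connected.exists_adj_dist_add_one (hT : T.Connected) {r v : V} (h : v ≠ r) :
    ∃ w, T.Adj w v ∧ T.dist r w + 1 = T.dist r v := by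
  obtain ⟨q, hq⟩ := hT.exists_walk_length_eq_dist v r
  cases q with
  | nil => exact absurd rfl h
  | @cons _ w _ hadj q =>
    refine ⟨w, hadj.symm, ?_⟩
    have h1 := dist_le q
    have h2 := hT.dist_triangle (u := v) (v := w) (w := r)
    rw [dist_eq_one_iff_adj.2 hadj] at h2
    rw [Walk.length_cons] at hq
    rw [dist_comm (u := r), dist_comm (u := r) (v := v)]
    omega

/-- Each such neighbour begins a shortest walk from `v` to `r`; shortest walks are paths, and the
path is unique. -/
lemma IsTree.eq_of_adj_of_dist_add_one (hT : T.IsTree) {r v w w' : V} (h : T.Adj w v)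
    (hd : T.dist r w + 1 = T.dist r v) (h' : T.Adj w' v) (hd' : T.dist r w' + 1 = T.dist r v) :
    w = w' := by
  have key {w : V} (h : T.Adj w v) (hd : T.dist r w + 1 = T.dist r v) :
      ∃ q : T.Walk v r, q.IsPath ∧ q.snd = w := by
    obtain ⟨q, hq⟩ := hT.connected.exists_walk_length_eq_dist w r
    refine ⟨.cons h.symm q, Walk.isPath_of_length_eq_dist _ ?_, by simp⟩
    rw [Walk.length_cons, hq, dist_comm, hd, dist_comm]
  obtain ⟨q, hq, rfl⟩ := key h hd
  obtain ⟨q', hq', rfl⟩ := key h' hd'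
  rw [(hT.existsUnique_path v r).unique hq hq']

/-- In a tree, a path whose first step leads away from `r` always leads away from `r`. -/
lemma IsTree.dist_of_isPath_cons (hT : T.IsTree) {r u v w : V} (h : T.Adj v u) (q : T.Walk u w)
    (hq : (Walk.cons h q).IsPath) (hd : T.dist r u = T.dist r v + 1) :
    T.dist r w = T.dist r v + 1 + q.length := by
  induction q generalizing v with
  | nil => exact hd
  | @cons u x w h' q ih =>
    have hd' : T.dist r x = T.dist r u + 1 := by
      rcases hT.dist_eq_dist_add_one_of_adj r h' with h1 | h1
      · exfalso
        have hvx := hT.eq_of_adj_of_dist_add_one h hd.symm h'.symm h1.symm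
        rw [Walk.cons_isPath_iff] at hq
        exact hq.2 (by simp [hvx])
      · exact h1
    rw [ih h' hq.of_cons hd', Walk.length_cons]
    omega

variable {G : Type*} [Group G] [MulAction G V]

lemma dist_smul (hadj : ∀ (g : G) x y, T.Adj x y → T.Adj (g • x) (g • y)) (g : G) (x y : V) :
    T.dist (g • x) (g • y) = T.dist x y := by
  have key (g : G) (x y : V) : T.edist (g • x) (g • y) ≤ T.edist x y := by
    refine le_iInf fun q => ?_
    let f : T →g T := ⟨fun v => g • v, fun h => hadj g _ _ h⟩
    exact (edist_le (q.map f)).trans_eq (by rw [Walk.length_map])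
  have h : T.edist (g • x) (g • y) = T.edist x y :=
    (key g x y).antisymm (by simpa using key g⁻¹ (g • x) (g • y))
  rw [dist, h, dist]

/-- Take a vertex `v` minimizing the largest distance `ρ` to the orbit of `o`. If `g` moved `v`, the
path from `v` to `g • v` would have length at least two, and its first interior vertex would have
smaller `ρ`. -/
lemma IsTree.exists_forall_smul_eq (hT : T.IsTree)
    (hadj : ∀ (g : G) x y, T.Adj x y → T.Adj (g • x) (g • y))
    (S : Subgroup G) [Finite S] (hinv : ∀ g ∈ S, ∀ x, ¬ T.Adj x (g • x)) :
    ∃ r : V, ∀ g ∈ S, g • r = r := by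
  have := Fintype.ofFinite S
  obtain ⟨o⟩ := hT.connected.nonempty
  let ρ : V → ℕ := fun v => Finset.univ.sup fun s : S => T.dist (s.1 • o) v
  have hρ (s : S) (v : V) : T.dist (s.1 • o) v ≤ ρ v :=
    Finset.le_sup (f := fun s : S => T.dist (s.1 • o) v) (Finset.mem_univ s)
  have hρ_smul (g : G) (hg : g ∈ S) (v : V) : ρ (g • v) ≤ ρ v := by
    refine Finset.sup_le fun s _ => ?_
    have : s.1 • o = g • (⟨g⁻¹ * s.1, S.mul_mem (S.inv_mem hg) s.2⟩ : S).1 • o := by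
      simp [mul_smul]
    rw [this, dist_smul hadj]
    exact hρ _ v
  obtain ⟨v, hv⟩ : ∃ v, ∀ w, ρ v ≤ ρ w := by
    obtain ⟨v, hv⟩ := WellFounded.has_min (measure ρ).wf Set.univ ⟨o, trivial⟩
    exact ⟨v, fun w => not_lt.1 (hv.2 w trivial)⟩
  refine ⟨v, fun g hg => ?_⟩
  by_contra hne
  obtain ⟨q, hq⟩ := (hT.existsUnique_path v (g • v)).exists
  have hle := hρ_smul g hg v
  have hna := hinv g hg v
  generalize g • v = w at q hq hle hne hna
  cases q with
  | nil => exact hne rfl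
  | @cons _ u _ h q =>
    have hlen : q.length ≠ 0 := fun h0 => hna (by rwa [← Walk.eq_of_length_eq_zero h0])
    have hlt (s : S) : T.dist (s.1 • o) u < ρ v := by
      rcases hT.dist_eq_dist_add_one_of_adj (s.1 • o) h with h1 | h1
      · have := hρ s v
        omega
      -- If `u` is further from the orbit point than `v`, the distance keeps growing up to `w`,
      -- where it is at most `ρ w ≤ ρ v`; as `q` is not trivial, the distance at `u` is strictly
      -- smaller.
      · have h2 := hT.dist_of_isPath_cons h q hq h1
        have := hρ s w
        omega
    exact (hv u).not_gt ((Finset.sup_lt_iff ((Nat.zero_le _).trans_lt (hlt 1))).2 fun s _ => hlt s)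

end SimpleGraph

/-! ### Subgroups, and groups acting on trees. -/

namespace HierarchyClass

/-- The hierarchy over the finite groups is closed under subgroups. -/
theorem of_injective {G : Type u} [Group G] (hG : HierarchyClass FiniteGroups FiniteGroups G)
    {H : Type u} [Group H] (f : H →* G) (hf : Function.Injective f) :
    HierarchyClass FiniteGroups FiniteGroups H := by
  induction hG generalizing H with
  | @of_mem G K _ _ e hK =>
    have : Finite K := hK
    exact of_mem (MulEquiv.refl H) (Finite.of_injective (e ∘ f) (e.injective.comp hf))
  | @of_action G _ X _ _ _ _ hdim hact hiso hfix ih =>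
    -- The same complex serves for `H`, acting through `f`: stabilizers embed, and `S` has the same
    -- fixed points as its finite image.
    let := MulAction.compHom X f
    refine of_action X hdim ?_ (fun x => ?_) fun S hS => ?_
    · exact ⟨fun h => hact.continuous_smul (f h), fun h => hact.exists_image_eq (f h),
        fun h => hact.smul_eq_of_image_eq (f h)⟩
    · let f' : MulAction.stabilizer H x →* MulAction.stabilizer G x :=
        (f.comp (Subgroup.subtype _)).codRestrict _ fun h => h.2
      exact ih x f' fun a b hab => Subtype.ext (hf (congrArg Subtype.val hab))
    · obtain ⟨K, _, hK, ⟨e⟩⟩ := hS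
      have h := hfix (S.map f) ⟨K, _, hK, ⟨(S.equivMapOfInjective f hf).symm.trans e⟩⟩
      have heq : MulAction.fixedPoints S X = MulAction.fixedPoints (S.map f) X := by
        ext x
        refine ⟨fun hx => ?_, fun hx s => hx ⟨f s.1, Subgroup.mem_map_of_mem f s.2⟩⟩
        rintro ⟨_, s, hs, rfl⟩
        exact hx ⟨s, hs⟩
      rw [heq]
      exact h

/-- A group that acts on a tree with an integral level that is increased by one along each oriented
edge and preserved by the elements of finite order belongs to the hierarchy if all vertex stabilizers
do. -/
theorem of_tree {G V : Type u} [Group G] [MulAction G V] (R : V → V → Prop) (level : V → ℤ)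
    (hR : ∀ (g : G) x y, R x y → R (g • x) (g • y)) (hlevel : ∀ x y, R x y → level y = level x + 1)
    (hinv : ∀ g : G, IsOfFinOrder g → ∀ x, level (g • x) = level x)
    (hT : (SimpleGraph.fromRel R).IsTree)
    (hstab : ∀ v : V, HierarchyClass FiniteGroups FiniteGroups (MulAction.stabilizer G v)) :
    HierarchyClass FiniteGroups FiniteGroups G := by
  classical
  have hneR {x y : V} (h : R x y) : x ≠ y := by
    rintro rfl
    have := hlevel _ _ h
    omega
  have hadj_iff (x y : V) : (SimpleGraph.fromRel R).Adj x y ↔ R x y ∨ R y x := by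
    rw [SimpleGraph.fromRel_adj]
    exact ⟨fun h => h.2, fun h => ⟨h.elim hneR fun h' => (hneR h').symm, h⟩⟩
  have hadj (g : G) (x y : V) (h : (SimpleGraph.fromRel R).Adj x y) :
      (SimpleGraph.fromRel R).Adj (g • x) (g • y) := by
    rw [hadj_iff] at h ⊢
    exact h.imp (hR g x y) (hR g y x)
  have hinvers (g : G) (hg : IsOfFinOrder g) (x : V) : ¬ (SimpleGraph.fromRel R).Adj x (g • x) := by
    rw [hadj_iff]
    rintro (h | h) <;> have := hlevel _ _ h <;> rw [hinv g hg] at this <;> omega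
  let := edgeAction hR
  have hne : ∀ e : {q : V × V // R q.1 q.2}, e.1.1 ≠ e.1.2 := fun e => hneR e.2
  let := GraphRealization.cwComplex hne
  have := GraphRealization.t2Space hne
  refine of_action (RelRealization R) (GraphRealization.finiteDimensional hne)
    (GraphRealization.isCellularAction hne (fun _ _ => rfl) fun _ _ => rfl) (fun x => ?_) ?_
  · have hle : ∃ v : V, MulAction.stabilizer G x ≤ MulAction.stabilizer G v := by
      induction x using GraphRealization.cases_point with
      | vertex v => exact ⟨v, fun g hg => GraphRealization.vertex_injective hg⟩
      | inner e s =>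
        refine ⟨e.1.1, fun g hg => ?_⟩
        have h : g • e = e := (GraphRealization.inner_inj.1 hg).1
        exact congrArg (fun e : {q : V × V // R q.1 q.2} => e.1.1) h
    obtain ⟨v, hv⟩ := hle
    exact (hstab v).of_injective (Subgroup.inclusion hv) (Subgroup.inclusion_injective hv)
  · rintro S ⟨K, _, hK, ⟨e⟩⟩
    have : Finite K := hK
    have : Finite S := Finite.of_injective e e.injective
    obtain ⟨r, hr⟩ := hT.exists_forall_smul_eq hadj S fun g hg =>
      hinvers g (S.subtype.isOfFinOrder (isOfFinOrder_of_finite (⟨g, hg⟩ : S)))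
    have hpar (v : V) : ∃ w, v ≠ r → (SimpleGraph.fromRel R).Adj w v ∧
        (SimpleGraph.fromRel R).dist r w + 1 = (SimpleGraph.fromRel R).dist r v := by
      by_cases h : v = r
      · exact ⟨v, fun h' => absurd h h'⟩
      · obtain ⟨w, hw⟩ := hT.connected.exists_adj_dist_add_one h
        exact ⟨w, fun _ => hw⟩
    choose p hp using hpar
    -- The choice `p r` is arbitrary; sending `r` to itself makes the parent map equivariant at the
    -- root too.
    let q : V → V := fun v => if v = r then r else p v
    have hdr {v : V} (h : (SimpleGraph.fromRel R).dist r v ≠ 0) : v ≠ r := by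
      rintro rfl
      exact h SimpleGraph.dist_self
    have hq {v : V} (h : v ≠ r) : q v = p v := if_neg h
    have huniq {v w : V} (h : (SimpleGraph.fromRel R).Adj w v)
        (h' : (SimpleGraph.fromRel R).dist r v = (SimpleGraph.fromRel R).dist r w + 1) :
        q v = w := by
      have hv : v ≠ r := hdr (by omega)
      rw [hq hv]
      exact hT.eq_of_adj_of_dist_add_one (hp v hv).1 (hp v hv).2 h h'.symm
    have hdist (g : G) (hg : g ∈ S) (v : V) : (SimpleGraph.fromRel R).dist r (g • v) =
        (SimpleGraph.fromRel R).dist r v := by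
      conv_lhs => rw [← hr g hg]
      exact SimpleGraph.dist_smul hadj g r v
    refine IsRooting.contractibleSpace_fixedPoints (r := r)
      (d := (SimpleGraph.fromRel R).dist r) (p := q) ?_ hR S hr hdist ?_
    · refine ⟨fun h => ((hT.connected.dist_eq_zero_iff).1 h).symm, fun h => ?_, fun h => ?_,
        fun {x y} h => ?_, fun {x y} h h' => ?_⟩
      · rw [hq (hdr h)]
        exact (hp _ (hdr h)).2
      · rw [hq (hdr h)]
        exact (hadj_iff _ _).1 (hp _ (hdr h)).1
      · have ha := (hadj_iff x y).2 (.inl h)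
        rcases hT.dist_eq_dist_add_one_of_adj r ha with h1 | h1
        · exact .inr ⟨h1, huniq ha.symm h1⟩
        · exact .inl ⟨h1, huniq ha h1⟩
      · have := hlevel _ _ h
        have := hlevel _ _ h'
        omega
    · intro g hg v
      by_cases hv : v = r
      · have hqr : q r = r := if_pos rfl
        rw [hv, hr g hg, hqr, hr g hg]
      · rw [hq hv]
        refine huniq (hadj g _ _ (hp v hv).1) ?_
        rw [hdist g hg, hdist g hg, (hp v hv).2]

end HierarchyClass

/-! ### Acyclicity from potentials. -/

/-- A graph is acyclic if for each edge there is a function that is constant along all other edges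
but not along this one. -/
lemma SimpleGraph.isAcyclic_fromRel {V : Type*} {R : V → V → Prop}
    (h : ∀ x y, R x y → ∃ F : V → ℤ, F x ≠ F y ∧
      ∀ x' y', R x' y' → (x', y') ≠ (x, y) → F x' = F y') :
    (SimpleGraph.fromRel R).IsAcyclic := by
  have key (x y : V) (hxy : R x y) : (SimpleGraph.fromRel R).IsBridge s(x, y) := by
    obtain ⟨F, hF, hF'⟩ := h x y hxy
    rw [isBridge_iff]
    rintro ⟨q⟩
    refine hF ?_
    generalize hT : (SimpleGraph.fromRel R).deleteEdges {s(x, y)} = T at q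
    clear hF
    -- A walk avoiding the edge would force `F x = F y`.
    have hconst (a b : V) (hab : T.Adj a b) : F a = F b := by
      rw [← hT, deleteEdges_adj, fromRel_adj] at hab
      rcases hab.1.2 with h' | h'
      · exact hF' a b h' fun he => hab.2 (by simp_all)
      · exact (hF' b a h' fun he => hab.2 (by simp_all [Sym2.eq_swap])).symm
    exact q.rec rfl fun h' _ ih => (hconst _ _ h').trans ih
  rw [isAcyclic_iff_forall_adj_isBridge]
  intro x y hxy
  rcases ((fromRel_adj R x y).1 hxy).2 with h' | h'
  · exact key x y h'
  · rw [Sym2.eq_swap]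
    exact key y x h'

lemma SimpleGraph.reachable_fromRel_smul {G V : Type*} [Group G] [MulAction G V]
    {R : V → V → Prop} (hR : ∀ (g : G) x y, R x y → R (g • x) (g • y)) (g : G) {x y : V}
    (h : (SimpleGraph.fromRel R).Reachable x y) :
    (SimpleGraph.fromRel R).Reachable (g • x) (g • y) := by
  let f : SimpleGraph.fromRel R →g SimpleGraph.fromRel R :=
    ⟨fun v => g • v, fun {x y} h => ⟨fun h' => h.1 (smul_left_cancel g h'),
      h.2.imp (hR g x y) (hR g y x)⟩⟩
  exact h.map f

/-! ### Directed unions and the tree of cosets. -/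

namespace HierarchyClass

lemma of_stabilizer_smul {G V : Type u} [Group G] [MulAction G V] {v : V} (g : G)
    (h : HierarchyClass FiniteGroups FiniteGroups (MulAction.stabilizer G v)) :
    HierarchyClass FiniteGroups FiniteGroups (MulAction.stabilizer G (g • v)) :=
  h.of_injective (MulAction.stabilizerEquivStabilizer (G := G) rfl).symm.toMonoidHom
    (MulEquiv.injective _)

lemma of_le {G : Type u} [Group G] {H K : Subgroup G}
    (h : HierarchyClass FiniteGroups FiniteGroups K) (hle : H ≤ K) :
    HierarchyClass FiniteGroups FiniteGroups H :=
  h.of_injective (Subgroup.inclusion hle) (Subgroup.inclusion_injective hle)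

lemma of_range {G K : Type u} [Group G] [Group K] {f : K →* G} (hf : Function.Injective f)
    (h : HierarchyClass FiniteGroups FiniteGroups K) :
    HierarchyClass FiniteGroups FiniteGroups f.range :=
  h.of_injective (MonoidHom.ofInjective hf).symm.toMonoidHom (MulEquiv.injective _)

lemma of_stabilizer_sigma {G : Type u} [Group G] {ι : Type} {H : ι → Subgroup G}
    (h : ∀ i, HierarchyClass FiniteGroups FiniteGroups (H i)) (v : Σ i, G ⧸ H i) :
    HierarchyClass FiniteGroups FiniteGroups (MulAction.stabilizer G v) := by
  obtain ⟨i, c⟩ := v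
  induction c using QuotientGroup.induction_on with
  | H g =>
    have hbase : HierarchyClass FiniteGroups FiniteGroups
        (MulAction.stabilizer G (⟨i, ((1 : G) : G ⧸ H i)⟩ : Σ i, G ⧸ H i)) := by
      refine (h i).of_le fun k hk => ?_
      have hk' : k • ((1 : G) : G ⧸ H i) = ((1 : G) : G ⧸ H i) := eq_of_heq (Sigma.mk.inj hk).2
      rwa [← MulAction.mem_stabilizer_iff, MulAction.stabilizer_quotient] at hk'
    have heq : (⟨i, (g : G ⧸ H i)⟩ : Σ i, G ⧸ H i) = g • ⟨i, ((1 : G) : G ⧸ H i)⟩ := by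
      rw [Sigma.smul_mk, MulAction.Quotient.smul_coe, smul_eq_mul, mul_one]
    rw [heq]
    exact hbase.of_stabilizer_smul g

/-- The parent of a coset in the tree of a sequence of subgroups. -/
def cosetParent {G : Type u} [Group G] {H : ℕ → Subgroup G} (hH : Monotone H)
    (x : Σ n, G ⧸ H n) : Σ n, G ⧸ H n :=
  ⟨x.1 + 1, Subgroup.quotientMapOfLE (hH x.1.le_succ) x.2⟩

/-- The potential is the indicator of the descendants of `x`. It jumps only between `x` and its
parent; the parent is not a descendant because the index increases. -/
lemma isAcyclic_cosetParent {G : Type u} [Group G] {H : ℕ → Subgroup G} (hH : Monotone H) :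
    (SimpleGraph.fromRel fun x y => y = cosetParent hH x).IsAcyclic := by
  classical
  have hfst (k : ℕ) (x : Σ n, G ⧸ H n) : ((cosetParent hH)^[k] x).1 = x.1 + k := by
    induction k generalizing x with
    | zero => rfl
    | succ k ih =>
      rw [Function.iterate_succ_apply, ih]
      change x.1 + 1 + k = _
      omega
  refine SimpleGraph.isAcyclic_fromRel fun x y hxy =>
    ⟨fun w => if ∃ k, (cosetParent hH)^[k] w = x then 1 else 0, ?_, fun x' y' hxy' hne => ?_⟩
  · have h1 : ∃ k, (cosetParent hH)^[k] x = x := ⟨0, rfl⟩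
    have h2 : ¬ ∃ k, (cosetParent hH)^[k] y = x := by
      rintro ⟨k, hk⟩
      have := hfst k y
      rw [hk, hxy] at this
      change x.1 = x.1 + 1 + k at this
      omega
    simp only [if_pos h1, if_neg h2]
    exact one_ne_zero
  · subst hxy hxy'
    refine if_congr ⟨?_, ?_⟩ rfl rfl
    · rintro ⟨_ | k, hk⟩
      · change x' = x at hk
        exact absurd (by rw [hk]) hne
      · exact ⟨k, hk⟩
    · rintro ⟨k, hk⟩
      exact ⟨k + 1, hk⟩

/-- The ancestors of the cosets of `a` and `b` coincide as soon as `a⁻¹ * b` lies in the subgroup.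
-/
lemma connected_cosetParent {G : Type u} [Group G] {H : ℕ → Subgroup G} (hH : Monotone H)
    (hG : ∀ g : G, ∃ n, g ∈ H n) :
    (SimpleGraph.fromRel fun x y => y = cosetParent hH x).Connected := by
  have hup (g : G) {n m : ℕ} (hnm : n ≤ m) :
      (SimpleGraph.fromRel fun x y => y = cosetParent hH x).Reachable
      ⟨n, (g : G ⧸ H n)⟩ ⟨m, (g : G ⧸ H m)⟩ := by
    induction m, hnm using Nat.le_induction with
    | base => rfl
    | succ m _ ih =>
      refine ih.trans (SimpleGraph.Adj.reachable ⟨fun h => ?_, .inl rfl⟩)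
      have := congrArg Sigma.fst h
      simp at this
  have : Nonempty (Σ n, G ⧸ H n) := ⟨⟨0, (1 : G)⟩⟩
  refine ⟨?_⟩
  rintro ⟨n, a⟩ ⟨m, b⟩
  induction a using QuotientGroup.induction_on with
  | H a =>
    induction b using QuotientGroup.induction_on with
    | H b =>
      obtain ⟨k, hk⟩ := hG (a⁻¹ * b)
      have h1 := hup a (le_max_left n (max m k))
      have h2 := hup b ((le_max_left m k).trans (le_max_right n _))
      have heq : (a : G ⧸ H (max n (max m k))) = b :=
        QuotientGroup.eq.2 (hH ((le_max_right m k).trans (le_max_right n _)) hk)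
      rw [heq] at h1
      exact h1.trans h2.symm

theorem of_monotone_union {G : Type u} [Group G] {H : ℕ → Subgroup G} (hH : Monotone H)
    (hG : ∀ g : G, ∃ n, g ∈ H n) (h : ∀ n, HierarchyClass FiniteGroups FiniteGroups (H n)) :
    HierarchyClass FiniteGroups FiniteGroups G := by
  refine of_tree (V := Σ n, G ⧸ H n) (fun x y => y = cosetParent hH x) (fun x => x.1) ?_ ?_
    (fun _ _ _ => rfl) ⟨connected_cosetParent hH hG, isAcyclic_cosetParent hH⟩
    (of_stabilizer_sigma h)
  · rintro g ⟨n, a⟩ _ rfl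
    induction a using QuotientGroup.induction_on with
    | H a => rfl
  · rintro x _ rfl
    exact Nat.cast_succ x.1

/-- A countable directed family contains a cofinal increasing sequence. -/
theorem of_directed_union {G : Type u} [Group G] {ι : Type*} [Countable ι] (H : ι → Subgroup G)
    (hH : Directed (· ≤ ·) H) (hG : ∀ g : G, ∃ i, g ∈ H i)
    (h : ∀ i, HierarchyClass FiniteGroups FiniteGroups (H i)) :
    HierarchyClass FiniteGroups FiniteGroups G := by
  have := Encodable.ofCountable ι
  obtain ⟨i, -⟩ := hG 1
  have : Inhabited ι := ⟨i⟩
  refine of_monotone_union hH.sequence_mono (fun g => ?_) fun n => h _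
  obtain ⟨i, hi⟩ := hG g
  exact ⟨_, hH.le_sequence i hi⟩

end HierarchyClass

/-! ### Affine actions on integral functions. -/

section Affine

variable {G : Type*} [Group G]

/-- The action of a group on the integral functions on it by translation. -/
def translation (G : Type*) [Group G] : G →* Equiv.Perm (G → ℤ) where
  toFun g := ⟨fun m x => m (g⁻¹ * x), fun m x => m (g * x), fun m => by simp, fun m => by simp⟩
  map_one' := by ext; simp
  map_mul' g h := by ext; simp [mul_assoc]

@[simp]
lemma translation_apply (g : G) (m : G → ℤ) (x : G) : translation G g m x = m (g⁻¹ * x) := rfl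

/-- The elements of a group that act on the integral functions by affine maps with linear part
given by translation. -/
def affineSubgroup (Θ : G →* Equiv.Perm (G → ℤ)) : Subgroup G where
  carrier := {g | ∀ m n, Θ g m - Θ g n = translation G g (m - n)}
  one_mem' m n := by simp
  mul_mem' {a b} ha hb m n := by
    rw [map_mul, Equiv.Perm.mul_apply, Equiv.Perm.mul_apply, ha, hb, map_mul,
      Equiv.Perm.mul_apply]
  inv_mem' {a} ha m n := by
    have := ha (Θ a⁻¹ m) (Θ a⁻¹ n)
    rw [← Equiv.Perm.mul_apply, ← Equiv.Perm.mul_apply, ← map_mul, mul_inv_cancel, map_one] at this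
    change m - n = _ at this
    rw [this, ← Equiv.Perm.mul_apply, ← map_mul, inv_mul_cancel, map_one]
    rfl

lemma mem_affineSubgroup {Θ : G →* Equiv.Perm (G → ℤ)} {g : G} :
    g ∈ affineSubgroup Θ ↔ ∀ m n, Θ g m - Θ g n = translation G g (m - n) := Iff.rfl

open Classical in
/-- The indicator function of a subgroup. -/
noncomputable def subgroupIndicator (C : Subgroup G) : G → ℤ := fun x => if x ∈ C then 1 else 0

lemma translation_subgroupIndicator {C : Subgroup G} {c : G} (hc : c ∈ C) :
    translation G c (subgroupIndicator C) = subgroupIndicator C := by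
  classical
  ext x
  rw [translation_apply, subgroupIndicator, subgroupIndicator]
  exact if_congr (C.mul_mem_cancel_left (C.inv_mem hc)) rfl rfl

lemma translation_subgroupIndicator_self (C : Subgroup G) (g : G) :
    translation G g (subgroupIndicator C) g = 1 := by
  rw [translation_apply, inv_mul_cancel, subgroupIndicator, if_pos C.one_mem]

lemma translation_subgroupIndicator_of_notMem {C : Subgroup G} {g x : G} (h : g⁻¹ * x ∉ C) :
    translation G g (subgroupIndicator C) x = 0 := by
  rw [translation_apply, subgroupIndicator, if_neg h]

/-- The orbit map `g H ↦ Θ g m` for a function `m` fixed by `H`. -/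
noncomputable def orbitPotential (Θ : G →* Equiv.Perm (G → ℤ)) {H : Subgroup G} (m : G → ℤ)
    (c : G ⧸ H) : G → ℤ := Θ c.out m

lemma orbitPotential_mk {Θ : G →* Equiv.Perm (G → ℤ)} {H : Subgroup G} {m : G → ℤ}
    (hm : ∀ h ∈ H, Θ h m = m) (g : G) : orbitPotential Θ m (g : G ⧸ H) = Θ g m := by
  obtain ⟨h, hh⟩ := QuotientGroup.mk_out_eq_mul H g
  rw [orbitPotential, hh, map_mul, Equiv.Perm.mul_apply, hm h h.2]

end Affine

/-! ### Amalgamated products. -/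

namespace Monoid.PushoutI

variable {A : Fin 2 → Type u} [∀ i, Group (A i)] {C : Type u} [Group C] {φ : ∀ i, C →* A i}

/-- The function fixed by the factor with index `i` in the affine action. -/
noncomputable def basePoint (φ : ∀ i, C →* A i) (i : Fin 2) : PushoutI φ → ℤ :=
  if i = 0 then 0 else subgroupIndicator (base φ).range

lemma translation_basePoint (i : Fin 2) (c : C) :
    translation (PushoutI φ) (base φ c) (basePoint φ i) = basePoint φ i := by
  unfold basePoint
  split_ifs
  · rfl
  · exact translation_subgroupIndicator ⟨c, rfl⟩

/-- The affine action of an amalgamated product for which the two factors have fixed points that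
differ by the indicator of the amalgamated subgroup. -/
noncomputable def affineAction (φ : ∀ i, C →* A i) :
    PushoutI φ →* Equiv.Perm (PushoutI φ → ℤ) :=
  -- Each factor acts by translation conjugated by the shift to its base point. The formulas agree
  -- on `C`, whose translations fix both base points.
  lift (fun i => (MulAut.conj (Equiv.addRight (basePoint φ i))).toMonoidHom.comp
    ((translation (PushoutI φ)).comp (of i))) ((translation (PushoutI φ)).comp (base φ)) (by
      intro i
      ext c m x
      have h := congrFun (translation_basePoint (φ := φ) i c) x
      simp only [translation_apply] at h
      simp [of_apply_eq_base, h])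

lemma affineAction_of (i : Fin 2) (a : A i) (m : PushoutI φ → ℤ) :
    affineAction φ (of i a) m =
      translation (PushoutI φ) (of i a) (m - basePoint φ i) + basePoint φ i := by
  rw [affineAction, lift_of]
  ext x
  simp [sub_eq_add_neg]

lemma affineAction_of_basePoint (i : Fin 2) (a : A i) :
    affineAction φ (of i a) (basePoint φ i) = basePoint φ i := by
  rw [affineAction_of]
  ext x
  simp

lemma affineAction_sub (g : PushoutI φ) (m n : PushoutI φ → ℤ) :
    affineAction φ g m - affineAction φ g n = translation _ g (m - n) := by
  have hof (i : Fin 2) (a : A i) : of i a ∈ affineSubgroup (affineAction φ) := by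
    intro m n
    rw [affineAction_of, affineAction_of]
    ext x
    simp
  revert m n
  rw [← mem_affineSubgroup]
  induction g using induction_on with
  | of i a => exact hof i a
  | base c => rw [← of_apply_eq_base φ 0]; exact hof 0 _
  | mul x y hx hy => exact mul_mem hx hy

/-- The edges of the Bass-Serre tree of an amalgamated product. -/
def treeRel (φ : ∀ i, C →* A i)
    (x y : Σ i, PushoutI φ ⧸ (of i : A i →* PushoutI φ).range) : Prop :=
  ∃ g : PushoutI φ, x = ⟨0, (g : PushoutI φ ⧸ _)⟩ ∧ y = ⟨1, (g : PushoutI φ ⧸ _)⟩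

lemma treeRel_smul (g : PushoutI φ)
    (x y : Σ i, PushoutI φ ⧸ (of i : A i →* PushoutI φ).range) (h : treeRel φ x y) :
    treeRel φ (g • x) (g • y) := by
  obtain ⟨k, rfl, rfl⟩ := h
  exact ⟨g * k, rfl, rfl⟩

/-- The potential sends the coset of `g` to the image of a base point under `g`. Its difference
along the edge of `g` is the indicator of the coset of `g` modulo the image of `C`, and this coset
determines the edge. -/
lemma isAcyclic_treeRel (φ : ∀ i, C →* A i) : (SimpleGraph.fromRel (treeRel φ)).IsAcyclic := by
  let F (v : Σ i, PushoutI φ ⧸ (of i : A i →* PushoutI φ).range) : PushoutI φ → ℤ :=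
    orbitPotential (affineAction φ) (basePoint φ v.1) v.2
  have hF (i : Fin 2) (g : PushoutI φ) :
      F ⟨i, (g : PushoutI φ ⧸ _)⟩ = affineAction φ g (basePoint φ i) := by
    refine orbitPotential_mk ?_ g
    rintro _ ⟨a, rfl⟩
    exact affineAction_of_basePoint i a
  have hdiff (g x : PushoutI φ) :
      F ⟨1, (g : PushoutI φ ⧸ _)⟩ x - F ⟨0, (g : PushoutI φ ⧸ _)⟩ x =
        translation _ g (subgroupIndicator (base φ).range) x := by
    rw [hF, hF, ← Pi.sub_apply, affineAction_sub]
    simp [basePoint]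
  refine SimpleGraph.isAcyclic_fromRel ?_
  rintro _ _ ⟨g, rfl, rfl⟩
  refine ⟨fun v => F v g, fun h => ?_, ?_⟩
  · have := hdiff g g
    rw [translation_subgroupIndicator_self] at this
    exact zero_ne_one ((sub_eq_zero.2 h.symm).symm.trans this)
  · rintro _ _ ⟨k, rfl, rfl⟩ hne
    have hk : k⁻¹ * g ∉ (base φ).range := by
      rintro ⟨c, hc⟩
      refine hne ?_
      have h (i : Fin 2) : (k : PushoutI φ ⧸ (of i : A i →* PushoutI φ).range) = g :=
        QuotientGroup.eq.2 ⟨φ i c, by rw [of_apply_eq_base, hc]⟩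
      rw [h 0, h 1]
    have := hdiff k g
    rw [translation_subgroupIndicator_of_notMem hk] at this
    exact (sub_eq_zero.1 this).symm

lemma connected_treeRel (φ : ∀ i, C →* A i) : (SimpleGraph.fromRel (treeRel φ)).Connected := by
  have hadj (g : PushoutI φ) : (SimpleGraph.fromRel (treeRel φ)).Reachable
      ⟨0, (g : PushoutI φ ⧸ _)⟩ ⟨1, (g : PushoutI φ ⧸ _)⟩ :=
    SimpleGraph.Adj.reachable
      ⟨fun h => absurd (congrArg Sigma.fst h) (by simp), .inl ⟨g, rfl, rfl⟩⟩
  have hof (i : Fin 2) (a : A i) : ((1 : PushoutI φ) : PushoutI φ ⧸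
      (of i : A i →* PushoutI φ).range) = (of i a : PushoutI φ) :=
    QuotientGroup.eq.2 ⟨a, by simp⟩
  have hreach (g : PushoutI φ) : (SimpleGraph.fromRel (treeRel φ)).Reachable
      ⟨0, ((1 : PushoutI φ) : PushoutI φ ⧸ _)⟩ ⟨0, (g : PushoutI φ ⧸ _)⟩ := by
    have hfactor (i : Fin 2) (a : A i) : (SimpleGraph.fromRel (treeRel φ)).Reachable
        ⟨0, ((1 : PushoutI φ) : PushoutI φ ⧸ _)⟩ ⟨0, (of i a : PushoutI φ)⟩ := by
      match i with
      | 0 => rw [← hof 0 a]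
      | 1 =>
        -- An element `a` of the second factor fixes that factor's base coset, so the walk passes
        -- through this common neighbour.
        have := hadj 1
        rw [hof 1 a] at this
        exact this.trans (hadj _).symm
    induction g using induction_on with
    | of i a => exact hfactor i a
    | base c => rw [← of_apply_eq_base φ 0]; exact hfactor 0 _
    | mul x y hx hy =>
      have := SimpleGraph.reachable_fromRel_smul treeRel_smul x hy
      simp only [Sigma.smul_mk, MulAction.Quotient.smul_coe, smul_eq_mul, mul_one] at this
      exact hx.trans this
  refine (SimpleGraph.connected_iff_exists_forall_reachable _).2
    ⟨⟨0, ((1 : PushoutI φ) : PushoutI φ ⧸ _)⟩, ?_⟩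
  rintro ⟨i, c⟩
  induction c using QuotientGroup.induction_on with
  | H g =>
    match i with
    | 0 => exact hreach g
    | 1 => exact (hreach g).trans (hadj g)

end Monoid.PushoutI

/-! ### HNN-extensions. -/

namespace HNNExtension

variable {K : Type u} [Group K] {A B : Subgroup K} {φ : A ≃* B}

/-- The affine action of an HNN-extension for which the base group is linear and the stable letter
moves the origin to the indicator of the second associated subgroup. -/
noncomputable def affineAction (φ : A ≃* B) :
    HNNExtension K A B φ →* Equiv.Perm (HNNExtension K A B φ → ℤ) :=
  lift ((translation _).comp of)
    (Equiv.addRight (subgroupIndicator (B.map of)) * translation _ t) (by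
      intro a
      ext m x
      have h := congrFun (translation_subgroupIndicator
        (Subgroup.mem_map_of_mem (of (φ := φ)) (φ a).2)) x
      simp only [translation_apply] at h
      -- The defining relation is respected because `t a = φ(a) t` and translation by `φ a` fixes
      -- the indicator of `B`.
      have h2 : t⁻¹ * ((of (φ a : K))⁻¹ * x) =
          (of (a : K) : HNNExtension K A B φ)⁻¹ * (t⁻¹ * x) := by
        rw [← mul_assoc, ← mul_assoc, ← mul_inv_rev, ← mul_inv_rev, t_mul_of]
      simp [h, h2])

lemma affineAction_of (k : K) (m : HNNExtension K A B φ → ℤ) :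
    affineAction φ (of k) m = translation _ (of k) m := by
  rw [affineAction, lift_of]
  rfl

lemma affineAction_t (m : HNNExtension K A B φ → ℤ) :
    affineAction φ t m = translation _ t m + subgroupIndicator (B.map of) := by
  rw [affineAction, lift_t]
  rfl

lemma affineAction_sub (g : HNNExtension K A B φ) (m n : HNNExtension K A B φ → ℤ) :
    affineAction φ g m - affineAction φ g n = translation _ g (m - n) := by
  revert m n
  rw [← mem_affineSubgroup]
  induction g using induction_on with
  | of k =>
    intro m n
    rw [affineAction_of, affineAction_of]
    rfl
  | t =>
    intro m n
    rw [affineAction_t, affineAction_t, add_sub_add_right_eq_sub]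
    rfl
  | mul x y hx hy => exact mul_mem hx hy
  | inv x hx => exact inv_mem hx

/-- The edges of the Bass-Serre tree of an HNN-extension. -/
def treeRel (φ : A ≃* B)
    (x y : HNNExtension K A B φ ⧸ (of : K →* HNNExtension K A B φ).range) : Prop :=
  ∃ g : HNNExtension K A B φ, x = (g : HNNExtension K A B φ ⧸ _) ∧
    y = ((g * t : HNNExtension K A B φ) : HNNExtension K A B φ ⧸ _)

lemma treeRel_smul (g : HNNExtension K A B φ)
    (x y : HNNExtension K A B φ ⧸ (of : K →* HNNExtension K A B φ).range) (h : treeRel φ x y) :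
    treeRel φ (g • x) (g • y) := by
  obtain ⟨k, rfl, rfl⟩ := h
  exact ⟨g * k, rfl, by rw [MulAction.Quotient.smul_coe, smul_eq_mul, mul_assoc]⟩

lemma isAcyclic_treeRel (φ : A ≃* B) : (SimpleGraph.fromRel (treeRel φ)).IsAcyclic := by
  let F (v : HNNExtension K A B φ ⧸ (of : K →* HNNExtension K A B φ).range) :=
    orbitPotential (affineAction φ) 0 v
  have hF (g : HNNExtension K A B φ) : F g = affineAction φ g 0 := by
    refine orbitPotential_mk ?_ g
    rintro _ ⟨k, rfl⟩
    rw [affineAction_of]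
    rfl
  have hdiff (g x : HNNExtension K A B φ) :
      F (g * t : HNNExtension K A B φ) x - F g x =
        translation _ g (subgroupIndicator (B.map of)) x := by
    rw [hF, hF, ← Pi.sub_apply, map_mul, Equiv.Perm.mul_apply, affineAction_sub, affineAction_t]
    rw [sub_zero]
    exact zero_add _
  refine SimpleGraph.isAcyclic_fromRel ?_
  rintro _ _ ⟨g, rfl, rfl⟩
  refine ⟨fun v => F v g, fun h => ?_, ?_⟩
  · have := hdiff g g
    rw [translation_subgroupIndicator_self] at this
    exact zero_ne_one ((sub_eq_zero.2 h.symm).symm.trans this)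
  · rintro _ _ ⟨k, rfl, rfl⟩ hne
    have hk : k⁻¹ * g ∉ B.map (of : K →* HNNExtension K A B φ) := by
      rintro ⟨b, hb, hbk⟩
      refine hne ?_
      obtain rfl : g = k * of b := by rw [hbk, mul_inv_cancel_left]
      -- For `b` in `B`, `k b t = k t φ⁻¹(b)`, so `k` and `k b` define the same edge, and the edges
      -- are separated by cosets of `B`.
      refine Prod.ext (QuotientGroup.eq.2 ⟨b, by simp⟩) (QuotientGroup.eq.2 ⟨φ.symm ⟨b, hb⟩, ?_⟩)
      rw [mul_assoc, of_mul_t ⟨b, hb⟩]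
      simp [mul_assoc]
    have := hdiff k g
    rw [translation_subgroupIndicator_of_notMem hk] at this
    exact (sub_eq_zero.1 this).symm

/-- The exponent sum of the stable letter. -/
def exponent (φ : A ≃* B) : HNNExtension K A B φ →* Multiplicative ℤ :=
  lift 1 (Multiplicative.ofAdd 1) (by simp)

/-- The exponent sum of the stable letter as a function on the vertices of the Bass-Serre tree. -/
noncomputable def level (φ : A ≃* B)
    (c : HNNExtension K A B φ ⧸ (of : K →* HNNExtension K A B φ).range) : ℤ :=
  (exponent φ c.out).toAdd

lemma level_mk (g : HNNExtension K A B φ) : level φ g = (exponent φ g).toAdd := by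
  obtain ⟨⟨_, k, rfl⟩, hk⟩ :=
    QuotientGroup.mk_out_eq_mul (of : K →* HNNExtension K A B φ).range g
  rw [level, hk, map_mul]
  simp [exponent]

lemma level_of_treeRel (x y : HNNExtension K A B φ ⧸ (of : K →* HNNExtension K A B φ).range)
    (h : treeRel φ x y) : level φ y = level φ x + 1 := by
  obtain ⟨k, rfl, rfl⟩ := h
  rw [level_mk, level_mk, map_mul]
  simp [exponent]

/-- The integers are torsion-free, so `g` has exponent sum zero. The stable letter does shift the
level. -/
lemma level_smul {g : HNNExtension K A B φ} (hg : IsOfFinOrder g)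
    (x : HNNExtension K A B φ ⧸ (of : K →* HNNExtension K A B φ).range) :
    level φ (g • x) = level φ x := by
  have h1 : exponent φ g = 1 :=
    (isOfFinOrder_iff_eq_one _).1 ((exponent φ).isOfFinOrder hg)
  induction x using QuotientGroup.induction_on with
  | H k =>
    rw [MulAction.Quotient.smul_coe, level_mk, level_mk, smul_eq_mul, map_mul, h1, one_mul]

lemma connected_treeRel (φ : A ≃* B) : (SimpleGraph.fromRel (treeRel φ)).Connected := by
  have hreach (g : HNNExtension K A B φ) : (SimpleGraph.fromRel (treeRel φ)).Reachable
      ((1 : HNNExtension K A B φ) : HNNExtension K A B φ ⧸ _)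
      (g : HNNExtension K A B φ ⧸ (of : K →* HNNExtension K A B φ).range) := by
    induction g using induction_on with
    | of k =>
      have : ((1 : HNNExtension K A B φ) : HNNExtension K A B φ ⧸
          (of : K →* HNNExtension K A B φ).range) = (of k : HNNExtension K A B φ) :=
        QuotientGroup.eq.2 ⟨k, by simp⟩
      rw [← this]
    | t =>
      have h : treeRel φ ((1 : HNNExtension K A B φ) : HNNExtension K A B φ ⧸ _)
          ((t : HNNExtension K A B φ) : HNNExtension K A B φ ⧸ _) := ⟨1, rfl, by rw [one_mul]⟩
      refine SimpleGraph.Adj.reachable ⟨fun he => ?_, .inl h⟩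
      have := level_of_treeRel _ _ h
      rw [he] at this
      omega
    | mul x y hx hy =>
      have := SimpleGraph.reachable_fromRel_smul treeRel_smul x hy
      simp only [MulAction.Quotient.smul_coe, smul_eq_mul, mul_one] at this
      exact hx.trans this
    | inv x hx =>
      have := SimpleGraph.reachable_fromRel_smul treeRel_smul x⁻¹ hx
      simp only [MulAction.Quotient.smul_coe, smul_eq_mul, mul_one, inv_mul_cancel] at this
      exact this.symm
  refine (SimpleGraph.connected_iff_exists_forall_reachable _).2
    ⟨((1 : HNNExtension K A B φ) : HNNExtension K A B φ ⧸ _), fun c => ?_⟩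
  induction c using QuotientGroup.induction_on with
  | H g => exact hreach g

end HNNExtension

/-! ### Application to the two Bass-Serre trees. -/

namespace HierarchyClass

theorem of_pushoutI {A : Fin 2 → Type u} [∀ i, Group (A i)] {C : Type u} [Group C]
    (φ : ∀ i, C →* A i) (hφ : ∀ i, Function.Injective (φ i))
    (hA : ∀ i, HierarchyClass FiniteGroups FiniteGroups (A i)) :
    HierarchyClass FiniteGroups FiniteGroups (Monoid.PushoutI φ) := by
  have hT : (SimpleGraph.fromRel (Monoid.PushoutI.treeRel φ)).IsTree :=
    ⟨Monoid.PushoutI.connected_treeRel φ, Monoid.PushoutI.isAcyclic_treeRel φ⟩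
  have hstab := of_stabilizer_sigma fun i => (hA i).of_range (Monoid.PushoutI.of_injective hφ i)
  have hlevel (x y : Σ i, Monoid.PushoutI φ ⧸ (Monoid.PushoutI.of (φ := φ) i).range)
      (h : Monoid.PushoutI.treeRel φ x y) : ((y.1 : ℕ) : ℤ) = (x.1 : ℕ) + 1 := by
    obtain ⟨g, rfl, rfl⟩ := h
    simp
  -- The level is the index `0` or `1` of the factor, which the whole group preserves.
  exact of_tree (G := Monoid.PushoutI φ) (Monoid.PushoutI.treeRel φ) (fun x => (x.1 : ℕ))
    Monoid.PushoutI.treeRel_smul hlevel (fun _ _ _ => by rw [Sigma.smul_def]; rfl) hT hstab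

theorem of_hnnExtension {K : Type u} [Group K] (A B : Subgroup K) (φ : A ≃* B)
    (hK : HierarchyClass FiniteGroups FiniteGroups K) :
    HierarchyClass FiniteGroups FiniteGroups (HNNExtension K A B φ) := by
  refine of_tree (HNNExtension.treeRel φ) (HNNExtension.level φ) HNNExtension.treeRel_smul
    HNNExtension.level_of_treeRel (fun g hg x => HNNExtension.level_smul hg x)
    ⟨HNNExtension.connected_treeRel φ, HNNExtension.isAcyclic_treeRel φ⟩ fun v => ?_
  induction v using QuotientGroup.induction_on with
  | H g =>
    have heq : (g : HNNExtension K A B φ ⧸ (HNNExtension.of : K →* HNNExtension K A B φ).range) =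
        g • ((1 : HNNExtension K A B φ) : HNNExtension K A B φ ⧸ _) := by
      rw [MulAction.Quotient.smul_coe, smul_eq_mul, mul_one]
    rw [heq]
    refine of_stabilizer_smul g ?_
    rw [MulAction.stabilizer_quotient]
    exact hK.of_range (HNNExtension.of_injective φ)

end HierarchyClass

theorem proposition5p3 :
    -- countable directed unions
    (∀ {G : Type u} [Group G] {ι : Type*} [Countable ι] (H : ι → Subgroup G),
      Directed (· ≤ ·) H → (∀ g : G, ∃ i, g ∈ H i) →
      (∀ i, HierarchyClass FiniteGroups FiniteGroups (H i)) →
      HierarchyClass FiniteGroups FiniteGroups G) ∧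
    -- amalgamated free products of two groups `A 0`, `A 1` over a common subgroup `C`
    (∀ {A : Fin 2 → Type u} [∀ i, Group (A i)] {C : Type u} [Group C] (φ : ∀ i, C →* A i),
      (∀ i, Function.Injective (φ i)) →
      (∀ i, HierarchyClass FiniteGroups FiniteGroups (A i)) →
      HierarchyClass FiniteGroups FiniteGroups (Monoid.PushoutI φ)) ∧
    -- HNN-extensions
    (∀ {K : Type u} [Group K] (A B : Subgroup K) (φ : A ≃* B),
      HierarchyClass FiniteGroups FiniteGroups K →
      HierarchyClass FiniteGroups FiniteGroups (HNNExtension K A B φ)) :=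
  ⟨HierarchyClass.of_directed_union, HierarchyClass.of_pushoutI, HierarchyClass.of_hnnExtension⟩
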